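/- For $i\in[n]$ let $D_i$ be the $2^n\times 2^n$ matrix, with rows and columns indexed by $\{0,1\}^n$, with $D_i(x,y)=1$ if $x_i\neq y_i$ and $D_i(x,y)=0$ otherwise. Let $\circ$ between matrices denote the entrywise product and $\|\cdot\|$ the spectral norm. For a Boolean function $g:\{0,1\}^n\to\{0,1\}$, the (negative-weight) adversary bound is $$\mathrm{ADV}^\pm(g)=\max_{\Gamma}\ \|\Gamma\|\quad\text{subject to}\quad \|\Gamma\circ D_i\|\le 1\ \text{ for all } i\in[n],\qquad \Gamma(x,y)=0\ \text{ whenever } g(x)=g(y),$$ over real symmetric $2^n\times 2^n$ matrices $\Gamma$. For a relation $f\subseteq\{0,1\}^n\times[K]$ such that for every $x\in\{0,1\}^n$ there is an $a\in[K]$ with $(x,a)\in f$, the relational adversary bound is $$\mathrm{ADV}^\pm_{rel}(f)=\min_{\{u_{x,i}\},\{v_{x,i}\},\{\sigma_{x,a}\}}\ \max\Big\{\max_{x}\sum_{i\in[n]}\|u_{x,i}\|^2,\ \max_{x}\sum_{i\in[n]}\|v_{x,i}\|^2\Big\}$$ over families of real vectors of arbitrary finite dimension, indexed by $x\in\{0,1\}^n$,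 $i\in[n]$ and $a\in[K]$, subject to $$\sum_{i:\,x_i\ne y_i}\langle u_{x,i},v_{y,i}\rangle=1-\sum_{a\in[K]}\langle\sigma_{x,a},\sigma_{y,a}\rangle\quad\text{for all } x,y\in\{0,1\}^n,\qquad \|\sigma_{x,a}\|^2=0\quad\text{whenever }(x,a)\notin f.$$ Theorem. Let $f\subseteq\{0,1\}^N\times[K]$ be a relation such that for every $z\in\{0,1\}^N$ there is an $a\in[K]$ with $(z,a)\in f$, and let $g:\{0,1\}^m\to\{0,1\}$ be a Boolean function. Let $f\circ g^N\subseteq\{0,1\}^{Nm}\times[K]$ be the relation consisting of all $(x,a)$, $x=(x_1,\dots,x_N)$ with blocks $x_p\in\{0,1\}^m$, such that $\big((g(x_1),\dots,g(x_N)),a\big)\in f$. Then $$\mathrm{ADV}^\pm_{rel}(f\circ g^N)=\mathrm{ADV}^\pm_{rel}(f)\cdot\mathrm{ADV}^\pm(g).$$ -/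

import Mathlib

/-! # The functional and the relational (negative-weight) adversary bounds -/

/-- The Boolean cube `{0,1}^n`. -/
abbrev Cube (n : ℕ) : Type := Fin n → Bool

/-- The `2^n`-by-`2^n` matrix `D_i`, with `D_i(x,y) = 1` iff `x_i ≠ y_i`, and `0` otherwise. -/
def diffMatrix {n : ℕ} (i : Fin n) : Matrix (Cube n) (Cube n) ℝ :=
  Matrix.of fun x y => if x i ≠ y i then 1 else 0

section FunctionalAdversary

-- In this section the norm of a matrix is the spectral norm (`ℓ²`-operator norm).
open scoped Matrix Matrix.Norms.L2Operator

/-- `Γ` is a functional adversary matrix for `g` (it is symmetric and vanishes at `(x, y)`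
whenever `g x = g y`). -/
def IsAdversaryMatrix {n : ℕ} (g : Cube n → Bool) (Γ : Matrix (Cube n) (Cube n) ℝ) : Prop :=
  Γ.IsSymm ∧ ∀ x y, g x = g y → Γ x y = 0

/-- The objective values `‖Γ‖` of the feasible points `Γ` of the maximization problem that
defines `ADV^±(g)`. -/
def advValues {n : ℕ} (g : Cube n → Bool) : Set ℝ :=
  {c | ∃ Γ : Matrix (Cube n) (Cube n) ℝ,
    IsAdversaryMatrix g Γ ∧ (∀ i, ‖Γ ⊙ diffMatrix i‖ ≤ 1) ∧ c = ‖Γ‖}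

/-- The functional adversary bound `ADV^±(g)`. -/
noncomputable def adv {n : ℕ} (g : Cube n → Bool) : ℝ :=
  sSup (advValues g)

/-- The supremum defining `adv` is over a nonempty set. -/
theorem advValues_nonempty {n : ℕ} (g : Cube n → Bool) : (advValues g).Nonempty :=
  ⟨‖(0 : Matrix (Cube n) (Cube n) ℝ)‖, 0, ⟨Matrix.isSymm_zero, fun _ _ _ => rfl⟩,
    fun i => by simp, rfl⟩

/-- The supremum defining `adv` is over a set that is bounded above. -/
theorem advValues_bddAbove {n : ℕ} (g : Cube n → Bool) : BddAbove (advValues g) := by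
  have hsum : ∀ Γ : Matrix (Cube n) (Cube n) ℝ,
      Γ = ∑ x, ∑ y, Γ x y • Matrix.single x y (1 : ℝ) := by
    intro Γ
    conv_lhs => rw [Matrix.matrix_eq_sum_single Γ]
    simp [Matrix.smul_single]
  have hentry : ∀ (A : Matrix (Cube n) (Cube n) ℝ) (x y), |A x y| ≤ ‖A‖ := by
    intro A x y
    have h := Matrix.l2_opNorm_mulVec A (EuclideanSpace.single y (1 : ℝ))
    have h2 := (PiLp.norm_apply_le
      ((EuclideanSpace.equiv (Cube n) ℝ).symm
        (A.mulVec (EuclideanSpace.single y (1 : ℝ)))) x).trans h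
    simpa using h2
  refine ⟨∑ x : Cube n, ∑ y : Cube n, ‖Matrix.single x y (1 : ℝ)‖, ?_⟩
  rintro c ⟨Γ, ⟨-, h0⟩, h1, rfl⟩
  conv_lhs => rw [hsum Γ]
  refine (norm_sum_le _ _).trans (Finset.sum_le_sum fun x _ => ?_)
  refine (norm_sum_le _ _).trans (Finset.sum_le_sum fun y _ => ?_)
  rw [norm_smul]
  refine mul_le_of_le_one_left (norm_nonneg _) ?_
  by_cases hxy : g x = g y
  · simp [h0 x y hxy]
  · have hne : x ≠ y := fun h => hxy (by rw [h])
    obtain ⟨i, hi⟩ := Function.ne_iff.mp hne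
    have h := (hentry _ x y).trans (h1 i)
    simpa [diffMatrix, hi] using h

end FunctionalAdversary

section RelationalAdversary

/-- A relation `f ⊆ {0,1}^n × [K]` is total if every `x` is related to at least one `a`. -/
def IsTotalRel {n K : ℕ} (f : Set (Cube n × Fin K)) : Prop :=
  ∀ x, ∃ a, (x, a) ∈ f

/-- The families of real vectors `u_{x,i}`, `v_{x,i}` (in `ℝ^d`) and `σ_{x,a}` (in `ℝ^e`) satisfy
the constraints of the minimization problem that defines `ADV_rel^±(f)`. -/
def IsRelFeasible {n K : ℕ} (f : Set (Cube n × Fin K)) {d e : ℕ}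
    (u v : Cube n → Fin n → EuclideanSpace ℝ (Fin d))
    (σ : Cube n → Fin K → EuclideanSpace ℝ (Fin e)) : Prop :=
  (∀ x y, ∑ i with x i ≠ y i, inner ℝ (u x i) (v y i) = 1 - ∑ a, inner ℝ (σ x a) (σ y a)) ∧
  ∀ x a, (x, a) ∉ f → ‖σ x a‖ ^ 2 = 0

/-- The objective function
`max {max_x ∑_i ‖u_{x,i}‖², max_x ∑_i ‖v_{x,i}‖²}`. -/
noncomputable def relCost {n d : ℕ} (u v : Cube n → Fin n → EuclideanSpace ℝ (Fin d)) : ℝ :=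
  max (Finset.univ.sup' Finset.univ_nonempty fun x => ∑ i, ‖u x i‖ ^ 2)
    (Finset.univ.sup' Finset.univ_nonempty fun x => ∑ i, ‖v x i‖ ^ 2)

/-- The objective values of the feasible points, in all finite dimensions, of the minimization
problem that defines `ADV_rel^±(f)`. -/
def advRelValues {n K : ℕ} (f : Set (Cube n × Fin K)) : Set ℝ :=
  {c | ∃ (d e : ℕ) (u v : Cube n → Fin n → EuclideanSpace ℝ (Fin d))
    (σ : Cube n → Fin K → EuclideanSpace ℝ (Fin e)), IsRelFeasible f u v σ ∧ c = relCost u v}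

/-- The relational adversary bound `ADV_rel^±(f)`. -/
noncomputable def advRel {n K : ℕ} (f : Set (Cube n × Fin K)) : ℝ :=
  sInf (advRelValues f)

/-- The infimum defining `advRel` is over a set that is bounded below. -/
theorem advRelValues_bddBelow {n K : ℕ} (f : Set (Cube n × Fin K)) :
    BddBelow (advRelValues f) := by
  refine ⟨0, ?_⟩
  rintro c ⟨d, e, u, v, σ, -, rfl⟩
  refine le_max_of_le_left (Finset.le_sup'_of_le _ (Finset.mem_univ fun _ => false) ?_)
  positivity

/-- For a total relation, the infimum defining `advRel` is over a nonempty set. -/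
theorem advRelValues_nonempty {n K : ℕ} (f : Set (Cube n × Fin K)) (hf : IsTotalRel f) :
    (advRelValues f).Nonempty := by
  classical
  choose s hs using hf
  let E : Cube n ≃ Fin (Fintype.card (Cube n)) := Fintype.equivFin _
  let u : Cube n → Fin n → EuclideanSpace ℝ (Fin (Fintype.card (Cube n))) :=
    fun x _ => EuclideanSpace.single (E x) 1
  let v : Cube n → Fin n → EuclideanSpace ℝ (Fin (Fintype.card (Cube n))) :=
    fun y _ => WithLp.toLp 2 fun k =>
      if s (E.symm k) = s y then 0
      else ((Finset.univ.filter fun i => E.symm k i ≠ y i).card : ℝ)⁻¹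
  let σ : Cube n → Fin K → EuclideanSpace ℝ (Fin 1) :=
    fun x a => if s x = a then EuclideanSpace.single 0 1 else 0
  refine ⟨relCost u v, _, _, u, v, σ, ⟨fun x y => ?_, fun x a hxa => ?_⟩, rfl⟩
  · have h1 : ∑ a, inner ℝ (σ x a) (σ y a) = if s x = s y then (1 : ℝ) else 0 := by
      rw [Finset.sum_eq_single (s x)]
      · by_cases h : s x = s y
        · simp [σ, h]
        · have h' : ¬ s y = s x := fun e => h e.symm
          simp [σ, h, h']
      · intro b _ hb
        have h' : ¬ s x = b := fun e => hb e.symm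
        simp [σ, h']
      · simp
    rw [h1]
    by_cases h : s x = s y
    · simp [u, v, h, EuclideanSpace.inner_single_left]
    · have hne : x ≠ y := fun e => h (by rw [e])
      obtain ⟨i, hi⟩ := Function.ne_iff.mp hne
      have hc : ((Finset.univ.filter fun i => x i ≠ y i).card : ℝ) ≠ 0 := by
        rw [Nat.cast_ne_zero]
        exact Finset.card_ne_zero_of_mem (Finset.mem_filter.mpr ⟨Finset.mem_univ i, hi⟩)
      simp only [u, v, h, EuclideanSpace.inner_single_left]
      simp only [Equiv.symm_apply_apply, h, if_false, Finset.sum_const, nsmul_eq_mul, map_one,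
        one_mul, sub_zero]
      exact mul_inv_cancel₀ hc
  · have h' : ¬ s x = a := fun e => hxa (e ▸ hs x)
    simp [σ, h']

end RelationalAdversary

section Composition

/-- The `p`-th block `x_p ∈ {0,1}^m` of `x = (x_1, …, x_N) ∈ {0,1}^{Nm}`; with indices starting
at `0`, its `q`-th bit is the bit of `x` at position `p * m + q`. -/
def block {N m : ℕ} (x : Cube (N * m)) (p : Fin N) : Cube m :=
  fun q => x (finProdFinEquiv (p, q))

/-- The string `(g(x_1), …, g(x_N))`. -/
def blockMap {N m : ℕ} (g : Cube m → Bool) (x : Cube (N * m)) : Cube N :=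
  fun p => g (block x p)

/-- The composed relation `f ∘ g^N = {(x, a) | ((g(x_1), …, g(x_N)), a) ∈ f}`. -/
def relComp {N m K : ℕ} (f : Set (Cube N × Fin K)) (g : Cube m → Bool) :
    Set (Cube (N * m) × Fin K) :=
  {xa | (blockMap g xa.1, xa.2) ∈ f}

end Composition

/-!
Lower bound. For an adversary matrix `Γ` of `g`, maximality of the quadratic form at a unit vector
forces its weight to split evenly between `g⁻¹(0)` and `g⁻¹(1)`; rescaling its two restrictions
gives unit vectors `δ_0`, `δ_1` with `⟨δ_b, (1 + Γ/‖Γ‖) δ_b'⟩ = 1` for all `b`, `b'`. Averaging a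
solution for `f ∘ g^N` against `ψ_z = δ_{z_1} ⊗ ⋯ ⊗ δ_{z_N}`, with `(1 + Γ/‖Γ‖)^{⊗N}` as Gram
matrix, gives a solution for `f`. A position in block `p` contributes the Gram matrix with `p`-th
factor replaced by `(Γ ∘ D_q)/‖Γ‖`; it factors as `Sᵀ T`, where on each fibre of `g^N` both `S` and
`T` have norm at most `‖Γ‖^{-1/2}` because `‖Γ ∘ D_q‖ ≤ 1`. So the cost is divided by `‖Γ‖`.

Upper bound. By separation of a point from a compact convex set, every `B > adv g` admits vectors
with `∑_{i : x_i ≠ y_i} ⟨w_{x,i}, w'_{y,i}⟩ = [g(x) ≠ g(y)]` and squared norms summing to at most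
`B`. Tensoring a solution for `f` with them gives a solution for `f ∘ g^N`, at `B` times the cost.
-/

section

open scoped Matrix MatrixOrder Matrix.Norms.L2Operator

/-! ### Real quadratic forms and the spectral norm -/

section QuadraticForm

variable {X Y : Type*} [Fintype X] [Fintype Y]

theorem real_dotProduct_self_nonneg (v : X → ℝ) : 0 ≤ v ⬝ᵥ v :=
  Finset.sum_nonneg fun x _ => mul_self_nonneg (v x)

theorem norm_toLp_sq_eq_dotProduct (v : X → ℝ) : ‖WithLp.toLp 2 v‖ ^ 2 = v ⬝ᵥ v := by
  simpa only [dotProduct, ← sq] using EuclideanSpace.real_norm_sq_eq (WithLp.toLp 2 v)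

theorem inner_toLp_eq_dotProduct (v w : X → ℝ) :
    inner ℝ (WithLp.toLp 2 v) (WithLp.toLp 2 w) = v ⬝ᵥ w := by
  rw [EuclideanSpace.inner_toLp_toLp, star_trivial, dotProduct_comm]

theorem dotProduct_mulVec_eq_sum {R : Type*} [CommSemiring R] (A : Matrix X Y R) (v : X → R)
    (w : Y → R) :
    v ⬝ᵥ (A *ᵥ w) = ∑ x, ∑ y, v x * w y * A x y := by
  simp only [dotProduct, Matrix.mulVec, Finset.mul_sum]
  exact Finset.sum_congr rfl fun x _ => Finset.sum_congr rfl fun y _ => by ring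

theorem mulVec_dotProduct_mulVec {R : Type*} [CommSemiring R] (A B : Matrix Y X R) (v w : X → R) :
    (A *ᵥ v) ⬝ᵥ (B *ᵥ w) = v ⬝ᵥ ((Aᵀ * B) *ᵥ w) := by
  rw [← Matrix.mulVec_mulVec, Matrix.dotProduct_mulVec v, Matrix.vecMul_transpose]

theorem dotProduct_mulVec_comm_of_isSymm {R : Type*} [CommSemiring R] {A : Matrix X X R}
    (hA : A.IsSymm) (v w : X → R) :
    v ⬝ᵥ (A *ᵥ w) = w ⬝ᵥ (A *ᵥ v) := by
  rw [← Matrix.dotProduct_transpose_mulVec, hA.eq]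

theorem posSemidef_iff_isSymm_and_dotProduct_mulVec {A : Matrix X X ℝ} :
    A.PosSemidef ↔ A.IsSymm ∧ ∀ v, 0 ≤ v ⬝ᵥ (A *ᵥ v) := by
  simp only [Matrix.posSemidef_iff_dotProduct_mulVec, Matrix.IsHermitian, Matrix.IsSymm,
    Matrix.conjTranspose_eq_transpose_of_trivial, star_trivial]

theorem exists_eq_transpose_mul_self {A : Matrix X X ℝ} (hA : A.PosSemidef) :
    ∃ B : Matrix X X ℝ, A = Bᵀ * B := by
  classical
  obtain ⟨B, hB⟩ := CStarAlgebra.nonneg_iff_eq_star_mul_self.mp hA.nonneg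
  exact ⟨B, hB⟩

section SpectralNorm

variable [DecidableEq X]

theorem mulVec_dotProduct_self_le (A : Matrix Y X ℝ) (v : X → ℝ) :
    (A *ᵥ v) ⬝ᵥ (A *ᵥ v) ≤ ‖A‖ ^ 2 * (v ⬝ᵥ v) := by
  rw [← norm_toLp_sq_eq_dotProduct, ← norm_toLp_sq_eq_dotProduct, ← mul_pow]
  exact pow_le_pow_left₀ (norm_nonneg _) (Matrix.l2_opNorm_mulVec A (WithLp.toLp 2 v)) 2

theorem abs_dotProduct_mulVec_self_le (A : Matrix X X ℝ) (v : X → ℝ) :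
    |v ⬝ᵥ (A *ᵥ v)| ≤ ‖A‖ * (v ⬝ᵥ v) := by
  rw [← inner_toLp_eq_dotProduct, ← norm_toLp_sq_eq_dotProduct]
  calc |inner ℝ (WithLp.toLp 2 v) (WithLp.toLp 2 (A *ᵥ v))|
      ≤ ‖WithLp.toLp 2 v‖ * ‖WithLp.toLp 2 (A *ᵥ v)‖ := abs_real_inner_le_norm _ _
    _ ≤ ‖WithLp.toLp 2 v‖ * (‖A‖ * ‖WithLp.toLp 2 v‖) := by
        gcongr
        exact Matrix.l2_opNorm_mulVec A (WithLp.toLp 2 v)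
    _ = ‖A‖ * ‖WithLp.toLp 2 v‖ ^ 2 := by ring

theorem posSemidef_norm_sq_smul_one_sub_transpose_mul_self (A : Matrix Y X ℝ) :
    (‖A‖ ^ 2 • 1 - Aᵀ * A).PosSemidef := by
  rw [posSemidef_iff_isSymm_and_dotProduct_mulVec]
  refine ⟨by simp [Matrix.IsSymm], fun v => ?_⟩
  rw [Matrix.sub_mulVec, dotProduct_sub, ← mulVec_dotProduct_mulVec, Matrix.smul_mulVec,
    Matrix.one_mulVec, dotProduct_smul, smul_eq_mul, sub_nonneg]
  exact mulVec_dotProduct_self_le A v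

theorem norm_le_of_abs_dotProduct_mulVec_self_le {A : Matrix X X ℝ} (hA : A.IsSymm) {c : ℝ}
    (hc : 0 ≤ c) (h : ∀ v, |v ⬝ᵥ (A *ᵥ v)| ≤ c * (v ⬝ᵥ v)) : ‖A‖ ≤ c := by
  have hsymm : (Matrix.toEuclideanCLM (n := X) (𝕜 := ℝ) A).IsSymmetric := fun v w => by
    rw [real_inner_comm]
    exact (Matrix.inner_toEuclideanCLM A w v).trans
      ((dotProduct_mulVec_comm_of_isSymm hA _ _).trans (Matrix.inner_toEuclideanCLM A v w).symm)
  rw [Matrix.cstar_norm_def, ContinuousLinearMap.norm_eq_iSup_rayleighQuotient _ hsymm]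
  refine ciSup_le fun v => ?_
  rw [ContinuousLinearMap.rayleighQuotient, abs_div, abs_sq]
  refine div_le_of_le_mul₀ (sq_nonneg _) hc ?_
  rw [ContinuousLinearMap.reApplyInnerSelf_apply, real_inner_comm, ← WithLp.toLp_ofLp 2 v,
    norm_toLp_sq_eq_dotProduct]
  simpa only [Matrix.inner_toEuclideanCLM, RCLike.re_to_real] using h v.ofLp

end SpectralNorm

end QuadraticForm

/-! ### Solutions of the relational program -/

section RelSolution

variable {I I' P Q X X' Z A ι κ ι' Y : Type*} [Fintype I] [Fintype I'] [Fintype P] [Fintype Q]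
  [Fintype A] [Fintype ι] [Fintype κ] [Fintype ι']

/-- A feasible point, of objective value at most `c`, of the minimization problem for `advRel`, with
the cube replaced by an arbitrary set `X` of inputs, `diffMatrix` by an arbitrary family `D` of
matrices, and vectors in `ℝ^ι` (for `u`, `v`) and `ℝ^κ` (for `σ`). -/
structure RelSolution (D : I → Matrix X X ℝ) (f : Set (X × A)) (ι κ : Type*) [Fintype ι]
    [Fintype κ] (c : ℝ) where
  u : X → I → ι → ℝ
  v : X → I → ι → ℝ
  σ : X → A → κ → ℝ
  sum_mul_dotProduct : ∀ x y,
    ∑ i, D i x y * (u x i ⬝ᵥ v y i) = 1 - ∑ a, σ x a ⬝ᵥ σ y a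
  σ_eq_zero : ∀ x a, (x, a) ∉ f → σ x a = 0
  u_le : ∀ x, ∑ i, u x i ⬝ᵥ u x i ≤ c
  v_le : ∀ x, ∑ i, v x i ⬝ᵥ v x i ≤ c

namespace RelSolution

variable {D : I → Matrix X X ℝ} {f : Set (X × A)} {c : ℝ}

/-- The pullback of a solution along a map of inputs and a relabelling of the positions. -/
def comap (s : RelSolution D f ι κ c) (φ : X' → X) (ε : I' ≃ I) {D' : I' → Matrix X' X' ℝ}
    {f' : Set (X' × A)} (hD : ∀ i x y, D' i x y = D (ε i) (φ x) (φ y))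
    (hf : ∀ x a, (φ x, a) ∈ f → (x, a) ∈ f') : RelSolution D' f' ι κ c where
  u x i := s.u (φ x) (ε i)
  v x i := s.v (φ x) (ε i)
  σ x := s.σ (φ x)
  sum_mul_dotProduct x y := by
    simp only [hD, ← s.sum_mul_dotProduct]
    exact Equiv.sum_comp ε fun i => D i (φ x) (φ y) * (s.u (φ x) i ⬝ᵥ s.v (φ y) i)
  σ_eq_zero x a h := s.σ_eq_zero _ _ (mt (hf x a) h)
  u_le x := (Equiv.sum_comp ε fun i => s.u (φ x) i ⬝ᵥ s.u (φ x) i).trans_le (s.u_le _)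
  v_le x := (Equiv.sum_comp ε fun i => s.v (φ x) i ⬝ᵥ s.v (φ x) i).trans_le (s.v_le _)

end RelSolution

/-- The tensor product of two vectors. -/
def tensorVec {R : Type*} [CommSemiring R] (a : ι → R) (b : ι' → R) : ι × ι' → R :=
  fun k => a k.1 * b k.2

theorem tensorVec_dotProduct {R : Type*} [CommSemiring R] (a b : ι → R) (c d : ι' → R) :
    tensorVec a c ⬝ᵥ tensorVec b d = (a ⬝ᵥ b) * (c ⬝ᵥ d) := by
  simp only [tensorVec, dotProduct, Fintype.sum_prod_type, Finset.sum_mul_sum, mul_mul_mul_comm]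

theorem sum_tensorVec_dotProduct_self_le {a : P → ι → ℝ} {w : P → Q → ι' → ℝ} {c d : ℝ}
    (ha : ∑ p, a p ⬝ᵥ a p ≤ c) (hw : ∀ p, ∑ q, w p q ⬝ᵥ w p q ≤ d) (hd : 0 ≤ d) :
    ∑ i : P × Q, tensorVec (a i.1) (w i.1 i.2) ⬝ᵥ tensorVec (a i.1) (w i.1 i.2) ≤ c * d := by
  simp only [Fintype.sum_prod_type, tensorVec_dotProduct, ← Finset.mul_sum]
  calc ∑ p, a p ⬝ᵥ a p * ∑ q, w p q ⬝ᵥ w p q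
      ≤ ∑ p, a p ⬝ᵥ a p * d := Finset.sum_le_sum fun p _ =>
        mul_le_mul_of_nonneg_left (hw p) (real_dotProduct_self_nonneg _)
    _ ≤ c * d := by
        rw [← Finset.sum_mul]
        exact mul_le_mul_of_nonneg_right ha hd

/-- Tensoring a solution with vectors `w`, `w'` that resolve each of its matrices `D p` into
matrices `E (p, q)`. -/
def RelSolution.tensor {D : P → Matrix Z Z ℝ} {f : Set (Z × A)} {c d : ℝ}
    (s : RelSolution D f ι κ c) (b : X → Z) {E : P × Q → Matrix X X ℝ}
    (w w' : X → P → Q → ι' → ℝ)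
    (hE : ∀ p x y, ∑ q, E (p, q) x y * (w x p q ⬝ᵥ w' y p q) = D p (b x) (b y)) (hd : 0 ≤ d)
    (hw : ∀ x p, ∑ q, w x p q ⬝ᵥ w x p q ≤ d) (hw' : ∀ x p, ∑ q, w' x p q ⬝ᵥ w' x p q ≤ d) :
    RelSolution E {xa : X × A | (b xa.1, xa.2) ∈ f} (ι × ι') κ (c * d) where
  u x i := tensorVec (s.u (b x) i.1) (w x i.1 i.2)
  v x i := tensorVec (s.v (b x) i.1) (w' x i.1 i.2)
  σ x := s.σ (b x)
  sum_mul_dotProduct x y := by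
    simp only [← s.sum_mul_dotProduct, ← hE, Fintype.sum_prod_type, tensorVec_dotProduct,
      Finset.sum_mul]
    exact Finset.sum_congr rfl fun p _ => Finset.sum_congr rfl fun q _ => by ring
  σ_eq_zero x := s.σ_eq_zero (b x)
  u_le x := sum_tensorVec_dotProduct_self_le (s.u_le (b x)) (hw x) hd
  v_le x := sum_tensorVec_dotProduct_self_le (s.v_le (b x)) (hw' x) hd

section Contract

variable [Fintype X] [Fintype Y]

/-- The image of the matrix with rows `φ x • U x` under `A`, as a vector. -/
def contractVec (A : Matrix Y X ℝ) (φ : X → ℝ) (U : X → ι → ℝ) : Y × ι → ℝ :=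
  fun k => (A *ᵥ fun x => φ x * U x k.2) k.1

theorem contractVec_dotProduct (A B : Matrix Y X ℝ) (φ χ : X → ℝ) (U V : X → ι → ℝ) :
    contractVec A φ U ⬝ᵥ contractVec B χ V =
      ∑ x, ∑ y, φ x * χ y * (Aᵀ * B) x y * (U x ⬝ᵥ V y) := by
  calc contractVec A φ U ⬝ᵥ contractVec B χ V
      = ∑ j, (A *ᵥ fun x => φ x * U x j) ⬝ᵥ (B *ᵥ fun y => χ y * V y j) := by
        simp only [contractVec, dotProduct, Fintype.sum_prod_type_right]
    _ = ∑ j, ∑ x, ∑ y, φ x * U x j * (χ y * V y j) * (Aᵀ * B) x y := by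
        exact Finset.sum_congr rfl fun j _ => by
          rw [mulVec_dotProduct_mulVec, dotProduct_mulVec_eq_sum]
    _ = ∑ x, ∑ y, φ x * χ y * (Aᵀ * B) x y * (U x ⬝ᵥ V y) := by
        simp only [dotProduct, Finset.mul_sum]
        rw [Finset.sum_comm]
        refine Finset.sum_congr rfl fun x _ => ?_
        rw [Finset.sum_comm]
        exact Finset.sum_congr rfl fun y _ => Finset.sum_congr rfl fun j _ => by ring

theorem contractVec_dotProduct_self_le {A : Matrix Y X ℝ} {φ : X → ℝ} {r : ℝ}
    (hA : ∀ χ, (∀ x, φ x = 0 → χ x = 0) → (A *ᵥ χ) ⬝ᵥ (A *ᵥ χ) ≤ r * (χ ⬝ᵥ χ))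
    (U : X → ι → ℝ) :
    contractVec A φ U ⬝ᵥ contractVec A φ U ≤ r * ∑ x, φ x ^ 2 * (U x ⬝ᵥ U x) := by
  calc contractVec A φ U ⬝ᵥ contractVec A φ U
      = ∑ j, (A *ᵥ fun x => φ x * U x j) ⬝ᵥ (A *ᵥ fun x => φ x * U x j) := by
        simp only [contractVec, dotProduct, Fintype.sum_prod_type_right]
    _ ≤ ∑ j, r * ((fun x => φ x * U x j) ⬝ᵥ fun x => φ x * U x j) :=
        Finset.sum_le_sum fun j _ => hA _ fun x hx => by rw [hx, zero_mul]
    _ = r * ∑ x, φ x ^ 2 * (U x ⬝ᵥ U x) := by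
        simp only [dotProduct, ← Finset.mul_sum]
        rw [Finset.sum_comm]
        simp only [Finset.mul_sum]
        exact Finset.sum_congr rfl fun x _ => Finset.sum_congr rfl fun j _ => by ring

theorem sum_contractVec_dotProduct_self_le {S : I → Matrix Y X ℝ} {φ : X → ℝ} {r c : ℝ}
    (hr : 0 ≤ r) (hφ : φ ⬝ᵥ φ = 1)
    (hS : ∀ i χ, (∀ x, φ x = 0 → χ x = 0) → (S i *ᵥ χ) ⬝ᵥ (S i *ᵥ χ) ≤ r * (χ ⬝ᵥ χ))
    {U : X → I → ι → ℝ} (hU : ∀ x, ∑ i, U x i ⬝ᵥ U x i ≤ c) :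
    ∑ i, contractVec (S i) φ (fun x => U x i) ⬝ᵥ contractVec (S i) φ (fun x => U x i) ≤
      r * c := by
  have hφ' : ∑ x, φ x ^ 2 = 1 := by simpa only [dotProduct, ← sq] using hφ
  calc ∑ i, contractVec (S i) φ (fun x => U x i) ⬝ᵥ contractVec (S i) φ (fun x => U x i)
      ≤ ∑ i, r * ∑ x, φ x ^ 2 * (U x i ⬝ᵥ U x i) :=
        Finset.sum_le_sum fun i _ => contractVec_dotProduct_self_le (hS i) _
    _ = r * ∑ x, φ x ^ 2 * ∑ i, U x i ⬝ᵥ U x i := by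
        rw [← Finset.mul_sum, Finset.sum_comm]
        simp only [Finset.mul_sum]
    _ ≤ r * ∑ x, φ x ^ 2 * c :=
        mul_le_mul_of_nonneg_left (Finset.sum_le_sum fun x _ =>
          mul_le_mul_of_nonneg_left (hU x) (sq_nonneg _)) hr
    _ = r * c := by rw [← Finset.sum_mul, hφ', one_mul]

theorem RelSolution.sum_gram_mul_dotProduct {E : I → Matrix X X ℝ} {f : Set (X × A)} {c : ℝ}
    (s : RelSolution E f ι κ c) {R : Matrix Y X ℝ} {φ χ : X → ℝ}
    (hR : φ ⬝ᵥ ((Rᵀ * R) *ᵥ χ) = 1) :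
    ∑ i, ∑ x, ∑ y, φ x * χ y * (Rᵀ * R) x y * (E i x y * (s.u x i ⬝ᵥ s.v y i)) =
      1 - ∑ a, contractVec R φ (fun x => s.σ x a) ⬝ᵥ contractVec R χ (fun x => s.σ x a) := by
  calc ∑ i, ∑ x, ∑ y, φ x * χ y * (Rᵀ * R) x y * (E i x y * (s.u x i ⬝ᵥ s.v y i))
      = ∑ x, ∑ y, φ x * χ y * (Rᵀ * R) x y * (1 - ∑ a, s.σ x a ⬝ᵥ s.σ y a) := by
        simp only [← s.sum_mul_dotProduct, Finset.mul_sum]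
        rw [Finset.sum_comm]
        exact Finset.sum_congr rfl fun x _ => Finset.sum_comm
    _ = 1 - ∑ a, contractVec R φ (fun x => s.σ x a) ⬝ᵥ contractVec R χ (fun x => s.σ x a) := by
        simp only [contractVec_dotProduct, mul_sub, mul_one, Finset.sum_sub_distrib,
          ← dotProduct_mulVec_eq_sum, hR, Finset.mul_sum]
        rw [Finset.sum_comm (γ := A)]
        simp only [Finset.sum_comm (γ := A)]

/-- The contraction of a solution along unit vectors `ψ z`: the matrices `S (p, q)` and `T (p, q)`
carry the positions `(p, q)` to the position `p`. -/
def RelSolution.contract {E : P × Q → Matrix X X ℝ} {f : Set (X × A)} {c : ℝ}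
    (s : RelSolution E f ι κ c) {D : P → Matrix Z Z ℝ} {f' : Set (Z × A)} (ψ : Z → X → ℝ)
    (R : Matrix Y X ℝ) (S T : P × Q → Matrix Y X ℝ) {r : ℝ} (hr : 0 ≤ r)
    (hψ : ∀ z, ψ z ⬝ᵥ ψ z = 1) (hR : ∀ z w, ψ z ⬝ᵥ ((Rᵀ * R) *ᵥ ψ w) = 1)
    (hf : ∀ z x a, ψ z x ≠ 0 → (x, a) ∈ f → (z, a) ∈ f')
    (hST : ∀ p q z w x y, D p z w * (ψ z x * ψ w y * ((S (p, q))ᵀ * T (p, q)) x y) =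
      ψ z x * ψ w y * ((Rᵀ * R) x y * E (p, q) x y))
    (hS : ∀ z i χ, (∀ x, ψ z x = 0 → χ x = 0) → (S i *ᵥ χ) ⬝ᵥ (S i *ᵥ χ) ≤ r * (χ ⬝ᵥ χ))
    (hT : ∀ z i χ, (∀ x, ψ z x = 0 → χ x = 0) → (T i *ᵥ χ) ⬝ᵥ (T i *ᵥ χ) ≤ r * (χ ⬝ᵥ χ)) :
    RelSolution D f' (Q × Y × ι) (Y × κ) (r * c) where
  u z p k := contractVec (S (p, k.1)) (ψ z) (fun x => s.u x (p, k.1)) k.2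
  v z p k := contractVec (T (p, k.1)) (ψ z) (fun x => s.v x (p, k.1)) k.2
  σ z a := contractVec R (ψ z) (fun x => s.σ x a)
  sum_mul_dotProduct z w := by
    calc _ = ∑ p, ∑ q, D p z w * (contractVec (S (p, q)) (ψ z) (fun x => s.u x (p, q)) ⬝ᵥ
          contractVec (T (p, q)) (ψ w) (fun x => s.v x (p, q))) := by
          simp only [dotProduct, Fintype.sum_prod_type (α₁ := Q), Finset.mul_sum]
      _ = ∑ p, ∑ q, ∑ x, ∑ y, ψ z x * ψ w y * (Rᵀ * R) x y *
          (E (p, q) x y * (s.u x (p, q) ⬝ᵥ s.v y (p, q))) := by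
          simp only [contractVec_dotProduct, Finset.mul_sum]
          refine Finset.sum_congr rfl fun p _ => Finset.sum_congr rfl fun q _ =>
            Finset.sum_congr rfl fun x _ => Finset.sum_congr rfl fun y _ => ?_
          linear_combination (s.u x (p, q) ⬝ᵥ s.v y (p, q)) * hST p q z w x y
      _ = ∑ i : P × Q, ∑ x, ∑ y, ψ z x * ψ w y * (Rᵀ * R) x y *
          (E i x y * (s.u x i ⬝ᵥ s.v y i)) := by
          simp only [Fintype.sum_prod_type (α₁ := P)]
      _ = 1 - ∑ a, contractVec R (ψ z) (fun x => s.σ x a) ⬝ᵥ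
          contractVec R (ψ w) (fun x => s.σ x a) := s.sum_gram_mul_dotProduct (hR z w)
  σ_eq_zero z a ha := by
    have hzero : ∀ x, ψ z x = 0 ∨ s.σ x a = 0 := fun x =>
      or_iff_not_imp_left.mpr fun hx => s.σ_eq_zero x a (mt (hf z x a hx) ha)
    funext k
    refine Finset.sum_eq_zero fun x _ => ?_
    obtain hx | hx := hzero x <;> simp [hx]
  u_le z := by
    simpa only [dotProduct, Fintype.sum_prod_type (α₁ := P),
      Fintype.sum_prod_type (α₁ := Q)] using
      sum_contractVec_dotProduct_self_le hr (hψ z) (hS z) s.u_le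
  v_le z := by
    simpa only [dotProduct, Fintype.sum_prod_type (α₁ := P),
      Fintype.sum_prod_type (α₁ := Q)] using
      sum_contractVec_dotProduct_self_le hr (hψ z) (hT z) s.v_le

end Contract

end RelSolution

section AdvRel

variable {n K : ℕ} {f : Set (Cube n × Fin K)}

theorem sum_diffMatrix_mul (x y : Cube n) (a : Fin n → ℝ) :
    ∑ i, diffMatrix i x y * a i = ∑ i with x i ≠ y i, a i := by
  simp only [diffMatrix, Matrix.of_apply, ite_mul, one_mul, zero_mul, Finset.sum_filter]

theorem advRel_nonneg (f : Set (Cube n × Fin K)) : 0 ≤ advRel f := by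
  refine Real.sInf_nonneg ?_
  rintro c ⟨d, e, u, v, σ, -, rfl⟩
  refine le_max_of_le_left (Finset.le_sup'_of_le _ (Finset.mem_univ fun _ => false) ?_)
  positivity

theorem RelSolution.advRel_le {ι κ : Type*} [Fintype ι] [Fintype κ] {c : ℝ}
    (s : RelSolution (diffMatrix (n := n)) f ι κ c) : advRel f ≤ c := by
  let ε := (Fintype.equivFin ι).symm
  let ε' := (Fintype.equivFin κ).symm
  let u x i := WithLp.toLp 2 (s.u x i ∘ ε)
  let v x i := WithLp.toLp 2 (s.v x i ∘ ε)
  let σ x a := WithLp.toLp 2 (s.σ x a ∘ ε')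
  have hfeasible : IsRelFeasible f u v σ := by
    refine ⟨fun x y => ?_, fun x a hxa => ?_⟩
    · simp only [u, v, σ, inner_toLp_eq_dotProduct, comp_equiv_dotProduct_comp_equiv,
        ← s.sum_mul_dotProduct, sum_diffMatrix_mul]
    · simp only [σ, norm_toLp_sq_eq_dotProduct, comp_equiv_dotProduct_comp_equiv,
        s.σ_eq_zero x a hxa, zero_dotProduct]
  have hcost : relCost u v ≤ c := by
    refine max_le (Finset.sup'_le _ _ fun x _ => ?_) (Finset.sup'_le _ _ fun x _ => ?_)
    · simpa only [u, norm_toLp_sq_eq_dotProduct, comp_equiv_dotProduct_comp_equiv] using s.u_le x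
    · simpa only [v, norm_toLp_sq_eq_dotProduct, comp_equiv_dotProduct_comp_equiv] using s.v_le x
  exact (csInf_le (advRelValues_bddBelow f) ⟨_, _, u, v, σ, hfeasible, rfl⟩).trans hcost

theorem exists_relSolution_of_mem_advRelValues {c : ℝ} (hc : c ∈ advRelValues f) :
    ∃ d e : ℕ, Nonempty (RelSolution (diffMatrix (n := n)) f (Fin d) (Fin e) c) := by
  obtain ⟨d, e, u, v, σ, ⟨h, hσ⟩, rfl⟩ := hc
  have hinner {k : ℕ} (a b : EuclideanSpace ℝ (Fin k)) : inner ℝ a b = a.ofLp ⬝ᵥ b.ofLp :=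
    inner_toLp_eq_dotProduct a.ofLp b.ofLp
  have hnorm {k : ℕ} (a : EuclideanSpace ℝ (Fin k)) : ‖a‖ ^ 2 = a.ofLp ⬝ᵥ a.ofLp :=
    norm_toLp_sq_eq_dotProduct a.ofLp
  refine ⟨d, e, ⟨{
    u x i := (u x i).ofLp
    v x i := (v x i).ofLp
    σ x a := (σ x a).ofLp
    sum_mul_dotProduct x y := by simpa only [hinner, sum_diffMatrix_mul] using h x y
    σ_eq_zero x a hxa := by simpa only [hnorm, dotProduct_self_eq_zero] using hσ x a hxa
    u_le x := ?_
    v_le x := ?_ }⟩⟩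
  · simp only [← hnorm]
    exact (Finset.le_sup' (fun x => ∑ i, ‖u x i‖ ^ 2) (Finset.mem_univ x)).trans (le_max_left _ _)
  · simp only [← hnorm]
    exact (Finset.le_sup' (fun x => ∑ i, ‖v x i‖ ^ 2) (Finset.mem_univ x)).trans (le_max_right _ _)

theorem exists_relSolution_of_advRel_lt (hf : IsTotalRel f) {c : ℝ} (hc : advRel f < c) :
    ∃ d e : ℕ, Nonempty (RelSolution (diffMatrix (n := n)) f (Fin d) (Fin e) c) := by
  obtain ⟨c', hc', hlt⟩ := exists_lt_of_csInf_lt (advRelValues_nonempty f hf) hc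
  obtain ⟨d, e, ⟨s⟩⟩ := exists_relSolution_of_mem_advRelValues hc'
  exact ⟨d, e, ⟨{ s with
    u_le := fun x => (s.u_le x).trans hlt.le
    v_le := fun x => (s.v_le x).trans hlt.le }⟩⟩

theorem IsTotalRel.relComp {N m : ℕ} {f : Set (Cube N × Fin K)} (hf : IsTotalRel f)
    (g : Cube m → Bool) : IsTotalRel (relComp f g) :=
  fun x => hf (blockMap g x)

end AdvRel

/-! ### Kronecker products over a finite family -/

section PiKronecker

variable {R ι X Y : Type*} [CommSemiring R] [Fintype ι]

/-- The tensor product of a finite family of vectors. -/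
def piTensor (a : ι → X → R) : (ι → X) → R :=
  fun x => ∏ p, a p (x p)

/-- The Kronecker product of a finite family of matrices. -/
def piKronecker (S : ι → Matrix Y X R) : Matrix (ι → Y) (ι → X) R :=
  Matrix.of fun y x => ∏ p, S p (y p) (x p)

theorem ne_zero_of_piTensor_ne_zero {a : ι → X → R} {x : ι → X} (h : piTensor a x ≠ 0) (p : ι) :
    a p (x p) ≠ 0 :=
  mt (fun hp => Finset.prod_eq_zero (Finset.mem_univ p) hp) h

theorem piKronecker_one [DecidableEq X] :
    piKronecker (fun _ : ι => (1 : Matrix X X R)) = 1 := by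
  ext x y
  simp only [piKronecker, Matrix.of_apply, Matrix.one_apply, Finset.prod_ite_zero,
    Finset.prod_const_one, Finset.mem_univ, true_imp_iff, funext_iff]

variable [DecidableEq ι]

theorem piKronecker_apply_eq_mul_prod_compl (S : ι → Matrix Y X R) (p : ι) (y : ι → Y)
    (x : ι → X) :
    piKronecker S y x = S p (y p) (x p) * ∏ p' ∈ {p}ᶜ, S p' (y p') (x p') :=
  Fintype.prod_eq_mul_prod_compl p _

theorem piKronecker_transpose_mul [Fintype Y] {X' : Type*} (S : ι → Matrix Y X R)
    (T : ι → Matrix Y X' R) :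
    (piKronecker S)ᵀ * piKronecker T = piKronecker fun p => (S p)ᵀ * T p := by
  ext x y
  simp only [Matrix.mul_apply, Matrix.transpose_apply, piKronecker, Matrix.of_apply,
    Finset.prod_univ_sum, Fintype.piFinset_univ, Finset.prod_mul_distrib]

variable [Fintype X]

theorem piTensor_dotProduct (a b : ι → X → R) :
    piTensor a ⬝ᵥ piTensor b = ∏ p, a p ⬝ᵥ b p := by
  simp only [dotProduct, piTensor, Finset.prod_univ_sum, Fintype.piFinset_univ,
    Finset.prod_mul_distrib]

theorem piKronecker_mulVec_piTensor (S : ι → Matrix Y X R) (a : ι → X → R) :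
    piKronecker S *ᵥ piTensor a = piTensor fun p => S p *ᵥ a p := by
  ext y
  simp only [Matrix.mulVec, dotProduct, piTensor, piKronecker, Matrix.of_apply,
    Finset.prod_univ_sum, Fintype.piFinset_univ, Finset.prod_mul_distrib]

variable [DecidableEq X]

theorem gram_piKronecker_apply {β : Type*} {g : X → β} {T : ι → Matrix X X R} {p : ι}
    (hT : ∀ p' ≠ p, ∀ x y, g x = g y → ((T p')ᵀ * T p') x y = (1 : Matrix X X R) x y)
    {x y : ι → X} (hxy : ∀ p', g (x p') = g (y p')) :
    ((piKronecker T)ᵀ * piKronecker T) x y =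
      ((T p)ᵀ * T p) (x p) (y p) * ∏ p' ∈ {p}ᶜ, (1 : Matrix X X R) (x p') (y p') := by
  rw [piKronecker_transpose_mul, piKronecker_apply_eq_mul_prod_compl _ p]
  exact congrArg _ (Finset.prod_congr rfl fun p' hp' =>
    hT p' (by simpa using hp') _ _ (hxy p'))

-- Completing the factor `T p` to `‖T p‖` times an isometry, by adding `E` to it as further rows,
-- turns the Kronecker product into `‖T p‖` times an isometry on each fibre.
theorem piKronecker_mulVec_dotProduct_self_le {β : Type*} {g : X → β} {T : ι → Matrix X X ℝ}
    {p : ι} (hT : ∀ p' ≠ p, ∀ x y, g x = g y → ((T p')ᵀ * T p') x y = (1 : Matrix X X ℝ) x y)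
    {z : ι → β} {φ : (ι → X) → ℝ} (hφ : ∀ x, φ x ≠ 0 → ∀ p, g (x p) = z p) :
    (piKronecker T *ᵥ φ) ⬝ᵥ (piKronecker T *ᵥ φ) ≤ ‖T p‖ ^ 2 * (φ ⬝ᵥ φ) := by
  obtain ⟨E, hE⟩ :=
    exists_eq_transpose_mul_self (posSemidef_norm_sq_smul_one_sub_transpose_mul_self (T p))
  let T' := Function.update T p E
  have hT' : ∀ p' ≠ p, ∀ x y, g x = g y →
      ((T' p')ᵀ * T' p') x y = (1 : Matrix X X ℝ) x y := fun p' hp' => by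
    simpa only [T', Function.update_of_ne hp'] using hT p' hp'
  have hgram : ∀ x y, (∀ p', g (x p') = g (y p')) →
      ((piKronecker T')ᵀ * piKronecker T') x y + ((piKronecker T)ᵀ * piKronecker T) x y =
        (‖T p‖ ^ 2 • (1 : Matrix (ι → X) (ι → X) ℝ)) x y := fun x y hxy => by
    rw [gram_piKronecker_apply hT' hxy, gram_piKronecker_apply hT hxy, ← add_mul,
      Matrix.smul_apply, ← piKronecker_one, piKronecker_apply_eq_mul_prod_compl _ p,
      ← smul_mul_assoc]
    simp only [T', Function.update_self, ← hE, Matrix.sub_apply, Matrix.smul_apply,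
      sub_add_cancel]
  have hsum : (piKronecker T' *ᵥ φ) ⬝ᵥ (piKronecker T' *ᵥ φ) +
      (piKronecker T *ᵥ φ) ⬝ᵥ (piKronecker T *ᵥ φ) = ‖T p‖ ^ 2 * (φ ⬝ᵥ φ) := by
    rw [← smul_eq_mul (‖T p‖ ^ 2), ← dotProduct_smul, ← Matrix.one_mulVec (‖T p‖ ^ 2 • φ),
      Matrix.mulVec_smul, ← Matrix.smul_mulVec, mulVec_dotProduct_mulVec,
      mulVec_dotProduct_mulVec]
    simp only [dotProduct_mulVec_eq_sum, ← Finset.sum_add_distrib, ← mul_add]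
    refine Finset.sum_congr rfl fun x _ => Finset.sum_congr rfl fun y _ => ?_
    by_cases hxy : φ x = 0 ∨ φ y = 0
    · rw [mul_eq_zero.mpr hxy, zero_mul, zero_mul]
    · obtain ⟨hx, hy⟩ := not_or.mp hxy
      rw [hgram x y fun p' => (hφ x hx p').trans (hφ y hy p').symm]
  have hnonneg := real_dotProduct_self_nonneg (piKronecker T' *ᵥ φ)
  linarith

end PiKronecker

/-! ### Singular vectors of an adversary matrix -/

theorem exists_isMax_dotProduct_mulVec_self {X : Type*} [Fintype X] [Nonempty X]
    (A : Matrix X X ℝ) :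
    ∃ v : X → ℝ, v ⬝ᵥ v = 1 ∧ ∀ w, w ⬝ᵥ (A *ᵥ w) ≤ v ⬝ᵥ (A *ᵥ v) * (w ⬝ᵥ w) := by
  obtain ⟨v, hv, hmax⟩ := (isCompact_sphere (0 : EuclideanSpace ℝ X) 1).exists_isMaxOn
    (NormedSpace.sphere_nonempty.mpr zero_le_one)
    (f := fun w => w.ofLp ⬝ᵥ (A *ᵥ w.ofLp)) (by fun_prop)
  have hv1 : ‖v‖ = 1 := by simpa using hv
  refine ⟨v.ofLp, by rw [← norm_toLp_sq_eq_dotProduct, WithLp.toLp_ofLp, hv1, one_pow],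
    fun w => ?_⟩
  obtain rfl | hw := eq_or_ne w 0
  · simp
  have hr : ‖WithLp.toLp 2 w‖ ≠ 0 := by simpa using hw
  have hmem : ‖WithLp.toLp 2 w‖⁻¹ • WithLp.toLp 2 w ∈ Metric.sphere (0 : EuclideanSpace ℝ X) 1 := by
    simp [norm_smul, hr]
  have hle := isMaxOn_iff.mp hmax _ hmem
  simp only [WithLp.ofLp_smul, Matrix.mulVec_smul, dotProduct_smul, smul_dotProduct,
    smul_eq_mul] at hle
  rw [← norm_toLp_sq_eq_dotProduct w]
  field_simp at hle
  linarith

section FibreScale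

variable {R X β : Type*} [CommSemiring R]

/-- The vector `v` with its restriction to each fibre `g⁻¹(b)` multiplied by `s b`. -/
def fibreScale (g : X → β) (s : β → R) (v : X → R) : X → R :=
  fun x => s (g x) * v x

theorem fibreScale_dotProduct [Fintype X] [Fintype β] [DecidableEq β] (g : X → β) (s t : β → R)
    (v : X → R) :
    fibreScale g s v ⬝ᵥ fibreScale g t v = ∑ b, s b * t b * ∑ x with g x = b, v x ^ 2 := by
  simp only [dotProduct, fibreScale, Finset.mul_sum]
  rw [← Finset.sum_fiberwise Finset.univ g]
  refine Finset.sum_congr rfl fun b _ => Finset.sum_congr rfl fun x hx => ?_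
  rw [(Finset.mem_filter.mp hx).2]
  ring

end FibreScale

namespace IsAdversaryMatrix

variable {m : ℕ} {g : Cube m → Bool} {Γ : Matrix (Cube m) (Cube m) ℝ}

theorem fibreScale_dotProduct_mulVec (hΓ : IsAdversaryMatrix g Γ) (s : Bool → ℝ)
    (v : Cube m → ℝ) :
    fibreScale g s v ⬝ᵥ (Γ *ᵥ fibreScale g s v) = s false * s true * (v ⬝ᵥ (Γ *ᵥ v)) := by
  simp only [dotProduct_mulVec_eq_sum, Finset.mul_sum]
  refine Finset.sum_congr rfl fun x _ => Finset.sum_congr rfl fun y _ => ?_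
  by_cases hxy : g x = g y
  · simp only [hΓ.2 x y hxy, mul_zero]
  · have hs : s (g x) * s (g y) = s false * s true := by
      cases hx : g x <;> cases hy : g y <;> simp_all [mul_comm]
    rw [← hs]
    simp only [fibreScale]
    ring

-- Changing the sign of `v` on `g⁻¹(1)` changes the sign of the quadratic form.
theorem abs_dotProduct_mulVec_self_le_sum (hΓ : IsAdversaryMatrix g Γ) {μ : Cube m → ℝ}
    (h : ∀ v, v ⬝ᵥ (Γ *ᵥ v) ≤ ∑ x, μ x * v x ^ 2) (v : Cube m → ℝ) :
    |v ⬝ᵥ (Γ *ᵥ v)| ≤ ∑ x, μ x * v x ^ 2 := by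
  let s : Bool → ℝ := fun b => cond b (-1) 1
  have hs : ∀ x, fibreScale g s v x ^ 2 = v x ^ 2 := fun x => by
    cases hx : g x <;> simp [fibreScale, s, hx]
  have hneg := h (fibreScale g s v)
  simp only [hs, hΓ.fibreScale_dotProduct_mulVec] at hneg
  exact abs_le'.mpr ⟨h v, by simpa [s] using hneg⟩

theorem exists_dotProduct_mulVec_self_eq_norm (hΓ : IsAdversaryMatrix g Γ) :
    ∃ v : Cube m → ℝ, v ⬝ᵥ v = 1 ∧ v ⬝ᵥ (Γ *ᵥ v) = ‖Γ‖ := by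
  obtain ⟨v, hv, hmax⟩ := exists_isMax_dotProduct_mulVec_self Γ
  refine ⟨v, hv, le_antisymm ?_ ?_⟩
  · simpa only [hv, mul_one] using (le_abs_self _).trans (abs_dotProduct_mulVec_self_le Γ v)
  · have hsum : ∀ w : Cube m → ℝ,
        ∑ x, v ⬝ᵥ (Γ *ᵥ v) * w x ^ 2 = v ⬝ᵥ (Γ *ᵥ v) * (w ⬝ᵥ w) := fun w => by
      simp only [dotProduct, ← Finset.mul_sum, sq]
    have habs : ∀ w, |w ⬝ᵥ (Γ *ᵥ w)| ≤ v ⬝ᵥ (Γ *ᵥ v) * (w ⬝ᵥ w) := fun w => by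
      rw [← hsum]
      exact hΓ.abs_dotProduct_mulVec_self_le_sum (fun w => (hmax w).trans_eq (hsum w).symm) w
    refine norm_le_of_abs_dotProduct_mulVec_self_le hΓ.1 ?_ habs
    simpa only [hv, mul_one] using (abs_nonneg _).trans (habs v)

-- First-order optimality of `v` in the direction that moves weight between the two fibres.
theorem sum_fibre_sq_eq_half (hΓ : IsAdversaryMatrix g Γ) (hpos : 0 < ‖Γ‖) {v : Cube m → ℝ}
    (hv : v ⬝ᵥ v = 1) (hmax : v ⬝ᵥ (Γ *ᵥ v) = ‖Γ‖) (b : Bool) :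
    ∑ x with g x = b, v x ^ 2 = 1 / 2 := by
  let w : Bool → ℝ := fun b => ∑ x with g x = b, v x ^ 2
  have hadd : w false + w true = 1 := by
    have hsum := fibreScale_dotProduct g 1 1 v
    simp only [Fintype.sum_bool, Pi.one_apply, one_mul] at hsum
    rw [add_comm, ← hsum, ← hv]
    simp [dotProduct, fibreScale]
  have hvar : ∀ t : ℝ, (1 + t) * (1 - t) ≤ (1 + t) ^ 2 * w false + (1 - t) ^ 2 * w true := by
    intro t
    let s : Bool → ℝ := fun b => cond b (1 - t) (1 + t)
    have hle := (le_abs_self _).trans (abs_dotProduct_mulVec_self_le Γ (fibreScale g s v))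
    rw [hΓ.fibreScale_dotProduct_mulVec, hmax, mul_comm, fibreScale_dotProduct,
      Fintype.sum_bool] at hle
    have hle_sum := le_of_mul_le_mul_left hle hpos
    simp only [s, cond_true, cond_false] at hle_sum
    linarith
  have heq : w false = w true := by
    nlinarith [hvar ((w true - w false) / 2), sq_nonneg (w true - w false)]
  change w b = 1 / 2
  cases b <;> linarith

theorem exists_singular_vectors (hΓ : IsAdversaryMatrix g Γ) (hpos : 0 < ‖Γ‖) :
    ∃ δ : Bool → Cube m → ℝ, (∀ b x, δ b x ≠ 0 → g x = b) ∧ (∀ b, δ b ⬝ᵥ δ b = 1) ∧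
      ∀ b b', δ b ⬝ᵥ ((1 + ‖Γ‖⁻¹ • Γ) *ᵥ δ b') = 1 := by
  obtain ⟨v, hv, hmax⟩ := hΓ.exists_dotProduct_mulVec_self_eq_norm
  let δ : Bool → Cube m → ℝ := fun b => fibreScale g (Pi.single b √2) v
  have hdot : ∀ b b', δ b ⬝ᵥ δ b' = if b = b' then 1 else 0 := fun b b' => by
    simp only [δ, fibreScale_dotProduct, hΓ.sum_fibre_sq_eq_half hpos hv hmax]
    cases b <;> cases b' <;> simp
  have hself : ∀ b, δ b ⬝ᵥ (Γ *ᵥ δ b) = 0 := fun b => by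
    rw [hΓ.fibreScale_dotProduct_mulVec]
    cases b <;> simp
  have hcross : δ false ⬝ᵥ (Γ *ᵥ δ true) = ‖Γ‖ := by
    have hsum : δ false + δ true = √2 • v := by
      funext x
      cases hx : g x <;> simp [δ, fibreScale, hx]
    have hform : (δ false + δ true) ⬝ᵥ (Γ *ᵥ (δ false + δ true)) = 2 * ‖Γ‖ := by
      rw [hsum, Matrix.mulVec_smul, smul_dotProduct, dotProduct_smul, smul_smul, hmax,
        Real.mul_self_sqrt zero_le_two, smul_eq_mul]
    rw [Matrix.mulVec_add, add_dotProduct, dotProduct_add, dotProduct_add, hself, hself,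
      dotProduct_mulVec_comm_of_isSymm hΓ.1 (δ true)] at hform
    linarith
  refine ⟨δ, fun b x hx => ?_, fun b => by simp [hdot], fun b b' => ?_⟩
  · by_contra hne
    exact hx (by simp [δ, fibreScale, hne])
  · rw [Matrix.add_mulVec, Matrix.one_mulVec, dotProduct_add, hdot, Matrix.smul_mulVec,
      dotProduct_smul, smul_eq_mul]
    cases b <;> cases b' <;>
      simp [hself, hcross, dotProduct_mulVec_comm_of_isSymm hΓ.1 (δ true), hpos.ne']

end IsAdversaryMatrix

/-! ### The lower bound -/

/-- The identification of strings of length `N * m` with families of `N` blocks. -/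
def blockEquiv (N m : ℕ) : Cube (N * m) ≃ (Fin N → Cube m) :=
  (Equiv.arrowCongr finProdFinEquiv.symm (Equiv.refl Bool)).trans (Equiv.curry _ _ _)

theorem block_blockEquiv_symm {N m : ℕ} (x : Fin N → Cube m) :
    block ((blockEquiv N m).symm x) = x :=
  (blockEquiv N m).apply_symm_apply x

theorem posSemidef_one_add_inv_norm_smul {X : Type*} [Fintype X] [DecidableEq X]
    {A : Matrix X X ℝ} (hA : A.IsSymm) : (1 + ‖A‖⁻¹ • A).PosSemidef := by
  refine posSemidef_iff_isSymm_and_dotProduct_mulVec.mpr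
    ⟨Matrix.isSymm_one.add (hA.smul _), fun v => ?_⟩
  have hform : |‖A‖⁻¹ * (v ⬝ᵥ (A *ᵥ v))| ≤ v ⬝ᵥ v := by
    calc |‖A‖⁻¹ * (v ⬝ᵥ (A *ᵥ v))| = ‖A‖⁻¹ * |v ⬝ᵥ (A *ᵥ v)| := by
          rw [abs_mul, abs_of_nonneg (inv_nonneg.mpr (norm_nonneg A))]
      _ ≤ ‖A‖⁻¹ * (‖A‖ * (v ⬝ᵥ v)) := by
          gcongr
          exact abs_dotProduct_mulVec_self_le A v
      _ = ‖A‖⁻¹ * ‖A‖ * (v ⬝ᵥ v) := (mul_assoc _ _ _).symm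
      _ ≤ v ⬝ᵥ v := mul_le_of_le_one_left (real_dotProduct_self_nonneg v) (inv_mul_le_one)
  rw [Matrix.add_mulVec, Matrix.one_mulVec, dotProduct_add, Matrix.smul_mulVec, dotProduct_smul,
    smul_eq_mul]
  linarith [(abs_le.mp hform).1]

namespace IsAdversaryMatrix

variable {N m K : ℕ} {f : Set (Cube N × Fin K)} {g : Cube m → Bool}
  {Γ R : Matrix (Cube m) (Cube m) ℝ}

theorem hadamard_diffMatrix (hΓ : IsAdversaryMatrix g Γ) (i : Fin m) :
    IsAdversaryMatrix g (Γ ⊙ diffMatrix i) := by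
  refine ⟨?_, fun x y hxy => by rw [Matrix.hadamard_apply, hΓ.2 x y hxy, zero_mul]⟩
  ext x y
  simp only [Matrix.transpose_apply, Matrix.hadamard_apply, diffMatrix, Matrix.of_apply,
    hΓ.1.apply x y, ne_comm]

theorem one_add_smul_apply_of_eq (hΓ : IsAdversaryMatrix g Γ) (c : ℝ) {x y : Cube m}
    (hxy : g x = g y) : (1 + c • Γ) x y = (1 : Matrix (Cube m) (Cube m) ℝ) x y := by
  rw [Matrix.add_apply, Matrix.smul_apply, hΓ.2 x y hxy, smul_zero, add_zero]

theorem piKronecker_update_mulVec_dotProduct_self_le (hΓ : IsAdversaryMatrix g Γ) {c : ℝ}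
    (hR : 1 + c • Γ = Rᵀ * R) (hc : 0 ≤ c) {A : Matrix (Cube m) (Cube m) ℝ} (hA : ‖A‖ ≤ 1)
    (p : Fin N) {z : Cube N} {φ : (Fin N → Cube m) → ℝ}
    (hφ : ∀ x, φ x ≠ 0 → ∀ p', g (x p') = z p') :
    (piKronecker (Function.update (fun _ => R) p (√c • A)) *ᵥ φ) ⬝ᵥ
      (piKronecker (Function.update (fun _ => R) p (√c • A)) *ᵥ φ) ≤ c * (φ ⬝ᵥ φ) := by
  have hnorm : ‖√c • A‖ ^ 2 ≤ c := by
    rw [norm_smul, mul_pow, Real.norm_of_nonneg (Real.sqrt_nonneg c), Real.sq_sqrt hc]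
    exact mul_le_of_le_one_right hc (pow_le_one₀ (norm_nonneg A) hA)
  refine (piKronecker_mulVec_dotProduct_self_le (g := g) (p := p) (fun p' hp' x y hxy => ?_)
    hφ).trans ?_
  · rw [Function.update_of_ne hp', ← hR, hΓ.one_add_smul_apply_of_eq c hxy]
  · rw [Function.update_self]
    exact mul_le_mul_of_nonneg_right hnorm (real_dotProduct_self_nonneg φ)

theorem diffMatrix_mul_piKronecker_update_gram (hΓ : IsAdversaryMatrix g Γ) {c : ℝ}
    (hR : 1 + c • Γ = Rᵀ * R) (hc : 0 ≤ c) (p : Fin N) (q : Fin m) {z w : Cube N}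
    {x y : Fin N → Cube m} (hx : g (x p) = z p) (hy : g (y p) = w p) :
    diffMatrix p z w *
        ((piKronecker (Function.update (fun _ => R) p (√c • 1)))ᵀ *
          piKronecker (Function.update (fun _ => R) p (√c • (Γ ⊙ diffMatrix q)))) x y =
      ((piKronecker fun _ : Fin N => R)ᵀ * piKronecker fun _ : Fin N => R) x y *
        diffMatrix q (x p) (y p) := by
  have hcompl : ∀ p' ∈ ({p}ᶜ : Finset (Fin N)), ∀ A B : Matrix (Cube m) (Cube m) ℝ,
      ((Function.update (fun _ => R) p A p')ᵀ * Function.update (fun _ => R) p B p') (x p') (y p')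
        = (Rᵀ * R) (x p') (y p') := fun p' hp' A B => by
    have hne : p' ≠ p := by simpa using hp'
    rw [Function.update_of_ne hne, Function.update_of_ne hne]
  have hfactor : diffMatrix p z w *
      ((√c • (1 : Matrix (Cube m) (Cube m) ℝ))ᵀ * √c • (Γ ⊙ diffMatrix q)) (x p) (y p) =
      (Rᵀ * R) (x p) (y p) * diffMatrix q (x p) (y p) := by
    rw [Matrix.transpose_smul, Matrix.transpose_one, Matrix.smul_mul, one_mul, smul_smul,
      Real.mul_self_sqrt hc, ← hR]
    by_cases hzw : z p = w p
    · rw [hΓ.one_add_smul_apply_of_eq c (by rw [hx, hy, hzw])]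
      obtain hxy | hxy := eq_or_ne (x p) (y p) <;> simp [diffMatrix, hzw, hxy]
    · have hne : x p ≠ y p := fun h => hzw (by rw [← hx, ← hy, h])
      simp only [Matrix.add_apply, Matrix.smul_apply, Matrix.hadamard_apply, smul_eq_mul,
        Matrix.one_apply_ne hne, zero_add, diffMatrix, Matrix.of_apply, if_pos hzw, ne_eq,
        one_mul, mul_assoc]
  rw [piKronecker_transpose_mul, piKronecker_transpose_mul,
    piKronecker_apply_eq_mul_prod_compl _ p, piKronecker_apply_eq_mul_prod_compl _ p,
    Function.update_self, Function.update_self,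
    Finset.prod_congr rfl fun p' hp' => hcompl p' hp' _ _, ← mul_assoc, hfactor, mul_right_comm]

end IsAdversaryMatrix

/-- A solution for `relComp f g`, with its strings read as families of blocks. -/
def RelSolution.ofRelComp {N m K : ℕ} {f : Set (Cube N × Fin K)} {g : Cube m → Bool}
    {ι κ : Type*} [Fintype ι] [Fintype κ] {c : ℝ}
    (s : RelSolution (diffMatrix (n := N * m)) (relComp f g) ι κ c) :
    RelSolution (fun (i : Fin N × Fin m) (x y : Fin N → Cube m) =>
      diffMatrix i.2 (x i.1) (y i.1)) {xa | (fun p => g (xa.1 p), xa.2) ∈ f} ι κ c :=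
  s.comap (blockEquiv N m).symm finProdFinEquiv
    (fun i x y => by
      have hblock : ∀ x : Fin N → Cube m,
          (blockEquiv N m).symm x (finProdFinEquiv i) = x i.1 i.2 := fun x =>
        congrFun (congrFun (block_blockEquiv_symm x) i.1) i.2
      simp only [diffMatrix, Matrix.of_apply, hblock])
    (fun x a hxa => by
      have hblock : blockMap g ((blockEquiv N m).symm x) = fun p => g (x p) :=
        funext fun p => congrArg g (congrFun (block_blockEquiv_symm x) p)
      simpa only [relComp, Set.mem_ofPred_eq, hblock] using hxa)

theorem IsAdversaryMatrix.advRel_le_inv_norm_mul {N m K : ℕ} {f : Set (Cube N × Fin K)}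
    {g : Cube m → Bool} {Γ : Matrix (Cube m) (Cube m) ℝ} (hΓ : IsAdversaryMatrix g Γ)
    (hD : ∀ i, ‖Γ ⊙ diffMatrix i‖ ≤ 1) {ι κ : Type*} [Fintype ι] [Fintype κ] {c : ℝ}
    (s : RelSolution (diffMatrix (n := N * m)) (relComp f g) ι κ c) (hpos : 0 < ‖Γ‖) :
    advRel f ≤ ‖Γ‖⁻¹ * c := by
  obtain ⟨δ, hδ, hδ_unit, hδ_form⟩ := hΓ.exists_singular_vectors hpos
  obtain ⟨R, hR⟩ := exists_eq_transpose_mul_self (posSemidef_one_add_inv_norm_smul hΓ.1)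
  have hinv : 0 ≤ ‖Γ‖⁻¹ := inv_nonneg.mpr hpos.le
  let ψ : Cube N → (Fin N → Cube m) → ℝ := fun z => piTensor fun p => δ (z p)
  have hψ : ∀ {z x}, ψ z x ≠ 0 → ∀ p, g (x p) = z p := fun h p =>
    hδ _ _ (ne_zero_of_piTensor_ne_zero h p)
  have hψ' : ∀ {z} {χ : (Fin N → Cube m) → ℝ}, (∀ x, ψ z x = 0 → χ x = 0) →
      ∀ x, χ x ≠ 0 → ∀ p, g (x p) = z p := fun hχ x hx => hψ (mt (hχ x) hx)
  refine (s.ofRelComp.contract (f' := f) (D := diffMatrix) ψ (piKronecker fun _ => R)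
    (fun i => piKronecker (Function.update (fun _ => R) i.1 (√‖Γ‖⁻¹ • 1)))
    (fun i => piKronecker (Function.update (fun _ => R) i.1 (√‖Γ‖⁻¹ • (Γ ⊙ diffMatrix i.2))))
    hinv (fun z => ?unit) (fun z w => ?gram) (fun z x a hzx hxa => ?mem)
    (fun p q z w x y => ?diff) (fun z i χ hχ => ?left) (fun z i χ hχ => ?right)).advRel_le
  case unit => simp only [ψ, piTensor_dotProduct, hδ_unit, Finset.prod_const_one]
  case gram =>
    simp only [ψ, piKronecker_transpose_mul, piKronecker_mulVec_piTensor, piTensor_dotProduct,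
      ← hR, hδ_form, Finset.prod_const_one]
  case mem => rwa [← funext (hψ hzx)]
  case diff =>
    by_cases hzero : ψ z x * ψ w y = 0
    · rw [hzero, zero_mul, zero_mul, mul_zero]
    · obtain ⟨hx, hy⟩ := mul_ne_zero_iff.mp hzero
      rw [mul_left_comm, hΓ.diffMatrix_mul_piKronecker_update_gram hR hinv p q (hψ hx p) (hψ hy p)]
  case left =>
    exact hΓ.piKronecker_update_mulVec_dotProduct_self_le hR hinv norm_one.le i.1 (hψ' hχ)
  case right =>
    exact hΓ.piKronecker_update_mulVec_dotProduct_self_le hR hinv (hD i.2) i.1 (hψ' hχ)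

section LowerBound

variable {N m K : ℕ} {f : Set (Cube N × Fin K)} {g : Cube m → Bool}

theorem IsAdversaryMatrix.advRel_mul_norm_le (hf : IsTotalRel f)
    {Γ : Matrix (Cube m) (Cube m) ℝ} (hΓ : IsAdversaryMatrix g Γ)
    (hD : ∀ i, ‖Γ ⊙ diffMatrix i‖ ≤ 1) : advRel f * ‖Γ‖ ≤ advRel (relComp f g) := by
  obtain hzero | hpos := (norm_nonneg Γ).eq_or_lt
  · rw [← hzero, mul_zero]
    exact advRel_nonneg _
  · refine le_of_forall_gt_imp_ge_of_dense fun c hc => ?_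
    obtain ⟨d, e, ⟨s⟩⟩ := exists_relSolution_of_advRel_lt (hf.relComp g) hc
    exact (le_inv_mul_iff₀' hpos).mp (hΓ.advRel_le_inv_norm_mul hD s hpos)

theorem advRel_mul_adv_le (hf : IsTotalRel f) (g : Cube m → Bool) :
    advRel f * adv g ≤ advRel (relComp f g) := by
  rw [adv, ← smul_eq_mul, ← Real.sSup_smul_of_nonneg (advRel_nonneg f)]
  refine Real.sSup_le ?_ (advRel_nonneg _)
  rintro _ ⟨_, ⟨Γ, hΓ, hD, rfl⟩, rfl⟩
  exact hΓ.advRel_mul_norm_le hf hD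

end LowerBound

/-! ### Strong duality by separation -/

-- By Carathéodory's theorem, convex combinations of boundedly many points suffice.
theorem isCompact_convexHull {E : Type*} [NormedAddCommGroup E] [NormedSpace ℝ E]
    [FiniteDimensional ℝ E] {s : Set E} (hs : IsCompact s) : IsCompact (convexHull ℝ s) := by
  let comb (k : ℕ) (p : (Fin k → ℝ) × (Fin k → E)) : E := ∑ i, p.1 i • p.2 i
  let combs (k : ℕ) : Set E := comb k '' stdSimplex ℝ (Fin k) ×ˢ Set.univ.pi fun _ => s
  have hcombs : ∀ k, IsCompact (combs k) := fun k =>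
    ((isCompact_stdSimplex ℝ _).prod (isCompact_univ_pi fun _ => hs)).image (by fun_prop)
  suffices convexHull ℝ s = ⋃ k ∈ Finset.range (Module.finrank ℝ E + 2), combs k by
    rw [this]
    exact Finset.isCompact_biUnion _ fun k _ => hcombs k
  refine Set.Subset.antisymm (fun x hx => ?_) (Set.iUnion₂_subset fun k _ => ?_)
  · obtain ⟨ι, _, z, w, hz, hindep, hw, hw_sum, rfl⟩ := eq_pos_convex_span_of_mem_convexHull hx
    let ε := (Fintype.equivFin ι).symm
    have hcard : Fintype.card ι < Module.finrank ℝ E + 2 :=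
      Nat.lt_succ_of_le <| hindep.card_le_finrank_succ.trans <|
        Nat.add_le_add_right (Submodule.finrank_le _) 1
    refine Set.mem_biUnion (Finset.mem_range.mpr hcard) ⟨(w ∘ ε, z ∘ ε), ⟨⟨fun i => (hw _).le, ?_⟩,
      fun i _ => hz (Set.mem_range_self _)⟩, Equiv.sum_comp ε fun i => w i • z i⟩
    exact (Equiv.sum_comp ε w).trans hw_sum
  · rintro _ ⟨⟨w, z⟩, ⟨hw, hz⟩, rfl⟩
    exact (convex_convexHull ℝ s).sum_mem (fun i _ => hw.1 i) hw.2 fun i _ =>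
      subset_convexHull ℝ s (hz i (Set.mem_univ i))

theorem isCompact_setOf_dotProduct_self_eq {X : Type*} [Fintype X] (r : ℝ) :
    IsCompact {v : X → ℝ | v ⬝ᵥ v = r} := by
  obtain hr | hr := lt_or_ge r 0
  · convert isCompact_empty
    exact Set.eq_empty_of_forall_notMem fun v hv =>
      (real_dotProduct_self_nonneg v).not_gt (hv.trans_lt hr)
  · convert (isCompact_sphere (0 : EuclideanSpace ℝ X) (√r)).image
      (PiLp.continuous_ofLp 2 fun _ : X => ℝ)
    ext v
    refine ⟨fun hv => ⟨WithLp.toLp 2 v, ?_, rfl⟩, ?_⟩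
    · rw [mem_sphere_zero_iff_norm, ← Real.sqrt_sq (norm_nonneg _), norm_toLp_sq_eq_dotProduct, hv]
    · rintro ⟨v, hv, rfl⟩
      rw [Set.mem_ofPred_eq, ← norm_toLp_sq_eq_dotProduct, WithLp.toLp_ofLp,
        mem_sphere_zero_iff_norm.mp hv, Real.sq_sqrt hr]

theorem dotProduct_mulVec_self_lt_of_forall_eq {X : Type*} [Fintype X] {A : Matrix X X ℝ}
    {r s : ℝ} (hr : 0 < r) (h : ∀ v, v ⬝ᵥ v = r → v ⬝ᵥ (A *ᵥ v) < s) {v : X → ℝ} (hv : v ≠ 0) :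
    v ⬝ᵥ (A *ᵥ v) < s / r * (v ⬝ᵥ v) := by
  have hpos : 0 < v ⬝ᵥ v :=
    (real_dotProduct_self_nonneg v).lt_of_ne' (mt dotProduct_self_eq_zero.mp hv)
  let t := √(r / (v ⬝ᵥ v))
  have ht : t * t = r / (v ⬝ᵥ v) := Real.mul_self_sqrt (div_pos hr hpos).le
  have hscaled := h (t • v) (by
    rw [smul_dotProduct, dotProduct_smul, smul_smul, ht, smul_eq_mul, div_mul_cancel₀ _ hpos.ne'])
  rw [Matrix.mulVec_smul, smul_dotProduct, dotProduct_smul, smul_smul, ht, smul_eq_mul,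
    div_mul_eq_mul_div, div_lt_iff₀ hpos, mul_comm r] at hscaled
  rwa [div_mul_eq_mul_div, lt_div_iff₀ hr]

theorem pos_of_forall_dotProduct_mulVec_lt {X : Type*} [Fintype X] {A : Matrix X X ℝ}
    {μ : X → ℝ} (h : ∀ v, v ≠ 0 → v ⬝ᵥ (A *ᵥ v) < ∑ x, μ x * v x ^ 2) {x : X}
    (hx : A x x = 0) : 0 < μ x := by
  classical
  simpa [Pi.single_apply, hx] using h (Pi.single x 1) (Pi.single_ne_zero_iff.mpr one_ne_zero)

section Duality

variable {I X : Type*} [Fintype X]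

/-- The point with coordinates `v x * v y * G i x y` and `v x ^ 2`. Solutions `w` of
`∑ i, G i x y * ⟨w x i, w y i⟩ = F x y` with `∑ i, ‖w x i‖ ^ 2 = c x` are the same as conic
combinations of such points that give the point with coordinates `F x y` and `c x`. -/
def momentPoint (G : I → Matrix X X ℝ) (i : I) (v : X → ℝ) : (X × X) ⊕ X → ℝ :=
  Sum.elim (fun e => v e.1 * v e.2 * G i e.1 e.2) fun x => v x ^ 2

/-- The moment points of the vectors of squared length `r`. -/
def momentPoints (G : I → Matrix X X ℝ) (r : ℝ) : Set ((X × X) ⊕ X → ℝ) :=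
  ⋃ i, momentPoint G i '' {v | v ⬝ᵥ v = r}

theorem isCompact_momentPoints [Finite I] (G : I → Matrix X X ℝ) (r : ℝ) :
    IsCompact (momentPoints G r) := by
  refine isCompact_iUnion fun i => (isCompact_setOf_dotProduct_self_eq r).image ?_
  refine continuous_pi fun e => ?_
  obtain e | x := e <;> simp only [momentPoint, Sum.elim_inl, Sum.elim_inr] <;> fun_prop

theorem exists_vectors_of_mem_convexHull_momentPoints [Fintype I] {G : I → Matrix X X ℝ} {r : ℝ}
    {F : Matrix X X ℝ} {c : X → ℝ}
    (h : Sum.elim (fun e : X × X => F e.1 e.2) c ∈ convexHull ℝ (momentPoints G r)) :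
    ∃ (κ : Type) (_ : Fintype κ) (w : X → I → κ → ℝ),
      (∀ x y, ∑ i, G i x y * (w x i ⬝ᵥ w y i) = F x y) ∧ ∀ x, ∑ i, w x i ⬝ᵥ w x i = c x := by
  classical
  obtain ⟨κ, _, t, z, ht, -, hz, hsum⟩ := mem_convexHull_iff_exists_fintype.mp h
  choose i v _ hv using fun k => Set.mem_iUnion.mp (hz k)
  let w : X → I → κ → ℝ := fun x j k => if i k = j then √(t k) * v k x else 0
  have hw : ∀ (a : I → ℝ) x y,
      ∑ j, a j * (w x j ⬝ᵥ w y j) = ∑ k, t k * (v k x * v k y * a (i k)) := fun a x y => by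
    simp only [dotProduct, Finset.mul_sum]
    rw [Finset.sum_comm]
    refine Finset.sum_congr rfl fun k _ => ?_
    simp only [w, ite_mul, mul_ite, zero_mul, mul_zero, Finset.sum_ite_eq, Finset.mem_univ,
      if_true]
    rw [← Real.mul_self_sqrt (ht k)]
    simp only [Real.sqrt_mul_self (Real.sqrt_nonneg _)]
    ring
  refine ⟨κ, inferInstance, w, fun x y => ?_, fun x => ?_⟩
  · simpa [← hv, momentPoint, hw] using congrFun hsum (Sum.inl (x, y))
  · have hw_one := hw (fun _ => 1) x x
    simp only [one_mul, mul_one] at hw_one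
    simpa [← hv, momentPoint, hw_one, sq] using congrFun hsum (Sum.inr x)

theorem exists_apply_sumElim_eq (ℓ : ((X × X) ⊕ X → ℝ) →ₗ[ℝ] ℝ) :
    ∃ (Ψ : Matrix X X ℝ) (μ : X → ℝ), ∀ W c,
      ℓ (Sum.elim W c) = ∑ x, ∑ y, Ψ x y * W (x, y) - ∑ x, μ x * c x := by
  classical
  refine ⟨Matrix.of fun x y => ℓ fun j => if Sum.inl (x, y) = j then 1 else 0,
    fun x => -ℓ fun j => if Sum.inr x = j then 1 else 0, fun W c => ?_⟩
  simp only [LinearMap.pi_apply_eq_sum_univ ℓ (Sum.elim W c), Fintype.sum_sum_type,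
    Fintype.sum_prod_type, Sum.elim_inl, Sum.elim_inr, smul_eq_mul, Matrix.of_apply, neg_mul,
    Finset.sum_neg_distrib, sub_neg_eq_add]
  simp only [mul_comm]

theorem exists_separating_of_notMem_convexHull_momentPoints [Finite I] {G : I → Matrix X X ℝ}
    {F : Matrix X X ℝ} {c : X → ℝ} (hc : 0 < ∑ x, c x)
    (h : Sum.elim (fun e : X × X => F e.1 e.2) c ∉ convexHull ℝ (momentPoints G (∑ x, c x))) :
    ∃ (Ψ : Matrix X X ℝ) (μ : X → ℝ),
      (∀ i v, v ≠ 0 → v ⬝ᵥ ((Ψ ⊙ G i) *ᵥ v) < ∑ x, μ x * v x ^ 2) ∧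
        ∑ x, μ x * c x < ∑ x, ∑ y, Ψ x y * F x y := by
  classical
  set r := ∑ x, c x with hr
  obtain ⟨ℓ, s, hlt, hgt⟩ := geometric_hahn_banach_closed_point (convex_convexHull ℝ _)
    (isCompact_convexHull (isCompact_momentPoints G r)).isClosed h
  obtain ⟨Ψ, μ, hℓ⟩ := exists_apply_sumElim_eq ℓ.toLinearMap
  simp only [ContinuousLinearMap.coe_coe] at hℓ
  have hform : ∀ (A : Matrix X X ℝ) (v : X → ℝ),
      v ⬝ᵥ ((A - Matrix.diagonal μ) *ᵥ v) = v ⬝ᵥ (A *ᵥ v) - ∑ x, μ x * v x ^ 2 := fun A v => by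
    rw [Matrix.sub_mulVec, dotProduct_sub]
    simp only [dotProduct, Matrix.mulVec_diagonal, mul_left_comm, sq]
  have hsphere : ∀ i v, v ⬝ᵥ v = r → v ⬝ᵥ ((Ψ ⊙ G i - Matrix.diagonal μ) *ᵥ v) < s :=
    fun i v hv => by
      have hmoment := hlt _ (subset_convexHull ℝ _
        (Set.mem_iUnion.mpr ⟨i, Set.mem_image_of_mem _ hv⟩))
      rw [momentPoint, hℓ] at hmoment
      simpa only [hform, dotProduct_mulVec_eq_sum, Matrix.hadamard_apply, mul_left_comm]
        using hmoment
  refine ⟨Ψ, fun x => μ x + s / r, fun i v hv => ?_, ?_⟩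
  · have hlt_mul := dotProduct_mulVec_self_lt_of_forall_eq hc (hsphere i) hv
    rw [hform, sub_lt_iff_lt_add'] at hlt_mul
    simpa only [add_mul, Finset.sum_add_distrib, ← Finset.mul_sum, dotProduct, sq] using hlt_mul
  · rw [hℓ] at hgt
    simp only [add_mul, Finset.sum_add_distrib, ← Finset.mul_sum, ← hr, div_mul_cancel₀ _ hc.ne']
    linarith

end Duality

theorem dotProduct_vecMulVec_hadamard_mulVec {R X : Type*} [CommSemiring R] [Fintype X]
    (A : Matrix X X R) (s v : X → R) :
    v ⬝ᵥ ((Matrix.vecMulVec s s ⊙ A) *ᵥ v) = (s * v) ⬝ᵥ (A *ᵥ (s * v)) := by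
  simp only [dotProduct_mulVec_eq_sum, Matrix.hadamard_apply, Matrix.vecMulVec_apply, Pi.mul_apply]
  exact Finset.sum_congr rfl fun x _ => Finset.sum_congr rfl fun y _ => by ring

theorem dotProduct_hadamard_symmetrization_mulVec {X : Type*} [Fintype X] {G : Matrix X X ℝ}
    (hG : G.IsSymm) (A : Matrix X X ℝ) (v : X → ℝ) :
    v ⬝ᵥ ((((2 : ℝ)⁻¹ • (A + Aᵀ)) ⊙ G) *ᵥ v) = v ⬝ᵥ ((A ⊙ G) *ᵥ v) := by
  have htranspose : v ⬝ᵥ ((Aᵀ ⊙ G) *ᵥ v) = v ⬝ᵥ ((A ⊙ G) *ᵥ v) := by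
    rw [← hG.eq, ← Matrix.transpose_hadamard, Matrix.dotProduct_transpose_mulVec, hG.eq]
  rw [Matrix.smul_hadamard, Matrix.add_hadamard, Matrix.smul_mulVec, Matrix.add_mulVec,
    dotProduct_smul, dotProduct_add, htranspose, ← two_mul, smul_eq_mul,
    inv_mul_cancel_left₀ two_ne_zero]

section Adversary

variable {m : ℕ} {g : Cube m → Bool} {Γ Ψ : Matrix (Cube m) (Cube m) ℝ}

theorem IsAdversaryMatrix.norm_le_adv (hΓ : IsAdversaryMatrix g Γ)
    (hD : ∀ i, ‖Γ ⊙ diffMatrix i‖ ≤ 1) : ‖Γ‖ ≤ adv g :=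
  le_csSup (advValues_bddAbove g) ⟨Γ, hΓ, hD, rfl⟩

theorem adv_nonneg (g : Cube m → Bool) : 0 ≤ adv g :=
  Real.sSup_nonneg (by
    rintro _ ⟨Γ, -, -, rfl⟩
    exact norm_nonneg Γ)

theorem IsAdversaryMatrix.one_dotProduct_mulVec_one_le (hΨ : IsAdversaryMatrix g Ψ)
    {μ : Cube m → ℝ} (hμ : ∀ x, 0 < μ x)
    (h : ∀ i v, v ⬝ᵥ ((Ψ ⊙ diffMatrix i) *ᵥ v) ≤ ∑ x, μ x * v x ^ 2) :
    1 ⬝ᵥ (Ψ *ᵥ 1) ≤ adv g * ∑ x, μ x := by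
  let t : Cube m → ℝ := fun x => √(μ x)
  let Γ := Matrix.vecMulVec t⁻¹ t⁻¹ ⊙ Ψ
  have ht : t⁻¹ * t = 1 := funext fun x => inv_mul_cancel₀ (Real.sqrt_pos.mpr (hμ x)).ne'
  have hΓ : IsAdversaryMatrix g Γ := by
    refine ⟨Matrix.IsSymm.ext fun x y => ?_, fun x y hxy => ?_⟩
    · simp only [Γ, Matrix.hadamard_apply, Matrix.vecMulVec_apply, hΨ.1.apply, mul_comm (t⁻¹ x)]
    · simp only [Γ, Matrix.hadamard_apply, hΨ.2 x y hxy, mul_zero]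
  have hD : ∀ i, ‖Γ ⊙ diffMatrix i‖ ≤ 1 := fun i => by
    refine norm_le_of_abs_dotProduct_mulVec_self_le (hΓ.hadamard_diffMatrix i).1 zero_le_one
      fun v => ?_
    rw [Matrix.hadamard_assoc, dotProduct_vecMulVec_hadamard_mulVec]
    refine ((hΨ.hadamard_diffMatrix i).abs_dotProduct_mulVec_self_le_sum (h i) _).trans_eq ?_
    rw [one_mul]
    refine Finset.sum_congr rfl fun x _ => ?_
    rw [Pi.mul_apply, Pi.inv_apply, mul_pow, inv_pow, Real.sq_sqrt (hμ x).le,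
      mul_inv_cancel_left₀ (hμ x).ne', sq]
  calc 1 ⬝ᵥ (Ψ *ᵥ 1) = t ⬝ᵥ (Γ *ᵥ t) := by rw [dotProduct_vecMulVec_hadamard_mulVec, ht]
    _ ≤ ‖Γ‖ * (t ⬝ᵥ t) := (le_abs_self _).trans (abs_dotProduct_mulVec_self_le Γ t)
    _ = ‖Γ‖ * ∑ x, μ x :=
        congrArg _ (Finset.sum_congr rfl fun x _ => Real.mul_self_sqrt (hμ x).le)
    _ ≤ adv g * ∑ x, μ x :=
        mul_le_mul_of_nonneg_right (hΓ.norm_le_adv hD) (Finset.sum_nonneg fun x _ => (hμ x).le)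

/-- The indicator matrix of the pairs on which `g` takes different values: the constraints of the
dual of the problem for `adv g` are `∑ i, diffMatrix i x y * ⟨w x i, w y i⟩ = 1` at these pairs. -/
def neMatrix {X β : Type*} [DecidableEq β] (g : X → β) : Matrix X X ℝ :=
  Matrix.of fun x y => if g x ≠ g y then 1 else 0

theorem sum_mul_le_adv_mul_sum {μ : Cube m → ℝ} (hμ : ∀ x, 0 < μ x)
    (h : ∀ i v, v ⬝ᵥ ((Ψ ⊙ (neMatrix g ⊙ diffMatrix i)) *ᵥ v) ≤ ∑ x, μ x * v x ^ 2) :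
    ∑ x, ∑ y, Ψ x y * neMatrix g x y ≤ adv g * ∑ x, μ x := by
  have hne : (neMatrix g).IsSymm := Matrix.IsSymm.ext fun x y => by
    simp only [neMatrix, Matrix.of_apply, ne_comm]
  have hD : ∀ i : Fin m, (neMatrix g ⊙ diffMatrix i).IsSymm := fun i =>
    Matrix.IsSymm.ext fun x y => by
      simp only [Matrix.hadamard_apply, hne.apply x y, diffMatrix, Matrix.of_apply, ne_comm]
  let Φ := ((2 : ℝ)⁻¹ • (Ψ + Ψᵀ)) ⊙ neMatrix g
  have hΦ : IsAdversaryMatrix g Φ := by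
    refine ⟨Matrix.IsSymm.ext fun x y => ?_, fun x y hxy => ?_⟩
    · simp only [Φ, Matrix.hadamard_apply, Matrix.smul_apply, Matrix.add_apply,
        Matrix.transpose_apply, hne.apply x y, add_comm]
    · simp only [Φ, Matrix.hadamard_apply, neMatrix, Matrix.of_apply, hxy, ne_eq, not_true,
        if_false, mul_zero]
  have hform : ∀ i v, v ⬝ᵥ ((Φ ⊙ diffMatrix i) *ᵥ v) =
      v ⬝ᵥ ((Ψ ⊙ (neMatrix g ⊙ diffMatrix i)) *ᵥ v) := fun i v => by
    rw [Matrix.hadamard_assoc, dotProduct_hadamard_symmetrization_mulVec (hD i)]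
  calc ∑ x, ∑ y, Ψ x y * neMatrix g x y = 1 ⬝ᵥ (Φ *ᵥ 1) := by
        rw [dotProduct_hadamard_symmetrization_mulVec hne, dotProduct_mulVec_eq_sum]
        simp only [Pi.one_apply, one_mul, Matrix.hadamard_apply]
    _ ≤ adv g * ∑ x, μ x := hΦ.one_dotProduct_mulVec_one_le hμ fun i v =>
        (hform i v).trans_le (h i v)

theorem exists_vectors_of_adv_lt {B : ℝ} (hB : adv g < B) :
    ∃ (κ : Type) (_ : Fintype κ) (w : Cube m → Fin m → κ → ℝ),
      (∀ x y, ∑ i, (neMatrix g ⊙ diffMatrix i) x y * (w x i ⬝ᵥ w y i) = neMatrix g x y) ∧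
        ∀ x, ∑ i, w x i ⬝ᵥ w x i ≤ B := by
  have hB_pos : 0 < B := (adv_nonneg g).trans_lt hB
  obtain hm | hm := isEmpty_or_nonempty (Fin m)
  · exact ⟨Empty, inferInstance, 0, fun x y => by simp [neMatrix, Subsingleton.elim x y],
      fun x => by simpa using hB_pos.le⟩
  by_cases h : Sum.elim (fun e : Cube m × Cube m => neMatrix g e.1 e.2) (fun _ => B) ∈
      convexHull ℝ (momentPoints (fun i => neMatrix g ⊙ diffMatrix i) (∑ _ : Cube m, B))
  · obtain ⟨κ, _, w, hw, hw_le⟩ := exists_vectors_of_mem_convexHull_momentPoints h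
    exact ⟨κ, inferInstance, w, hw, fun x => (hw_le x).le⟩
  · obtain ⟨Ψ, μ, hΨ, hlt⟩ := exists_separating_of_notMem_convexHull_momentPoints
      (Finset.sum_pos (fun _ _ => hB_pos) Finset.univ_nonempty) h
    have hμ : ∀ x, 0 < μ x := fun x =>
      pos_of_forall_dotProduct_mulVec_lt (hΨ hm.some) (by simp [diffMatrix])
    have hle : ∑ x, ∑ y, Ψ x y * neMatrix g x y ≤ adv g * ∑ x, μ x :=
      sum_mul_le_adv_mul_sum hμ fun i v => by
        obtain rfl | hv := eq_or_ne v 0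
        · simp
        · exact (hΨ i v hv).le
    rw [← Finset.sum_mul, mul_comm] at hlt
    exact absurd (hle.trans (mul_le_mul_of_nonneg_right hB.le
      (Finset.sum_nonneg fun x _ => (hμ x).le))) hlt.not_ge

end Adversary

/-! ### The upper bound -/

section UpperBound

variable {m : ℕ} {g : Cube m → Bool}

theorem exists_asymmetric_vectors_of_adv_lt {B : ℝ} (hB : adv g < B) :
    ∃ (κ : Type) (_ : Fintype κ) (w w' : Cube m → Fin m → κ → ℝ),
      (∀ x y, ∑ i, diffMatrix i x y * (w x i ⬝ᵥ w' y i) = neMatrix g x y) ∧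
        (∀ x, ∑ i, w x i ⬝ᵥ w x i ≤ B) ∧ ∀ x, ∑ i, w' x i ⬝ᵥ w' x i ≤ B := by
  obtain ⟨κ, _, w, hw, hw_le⟩ := exists_vectors_of_adv_lt hB
  let e (b : Bool) : Bool → ℝ := Pi.single b 1
  have he_self : ∀ b, e b ⬝ᵥ e b = 1 := fun b => by simp [e]
  have he_not : ∀ x y, e (g x) ⬝ᵥ e (!g y) = neMatrix g x y := fun x y => by
    cases hx : g x <;> cases hy : g y <;> simp [e, neMatrix, hx, hy]
  refine ⟨κ × Bool, inferInstance, fun x i => tensorVec (w x i) (e (g x)),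
    fun x i => tensorVec (w x i) (e (!g x)), fun x y => ?_, fun x => ?_, fun x => ?_⟩
  · rw [← hw x y]
    refine Finset.sum_congr rfl fun i _ => ?_
    rw [tensorVec_dotProduct, he_not, Matrix.hadamard_apply]
    ring
  · simpa only [tensorVec_dotProduct, he_self, mul_one] using hw_le x
  · simpa only [tensorVec_dotProduct, he_self, mul_one] using hw_le x

theorem advRel_relComp_le {N K : ℕ} {f : Set (Cube N × Fin K)} (hf : IsTotalRel f)
    (g : Cube m → Bool) : advRel (relComp f g) ≤ advRel f * adv g := by
  refine le_mul_of_forall_lt₀ fun c hc B hB => ?_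
  obtain ⟨d, e, ⟨s⟩⟩ := exists_relSolution_of_advRel_lt hf hc
  obtain ⟨κ, _, w, w', hw, hw_le, hw'_le⟩ := exists_asymmetric_vectors_of_adv_lt hB
  refine ((s.tensor (fun x p => g (x p)) (E := fun i x y => diffMatrix i.2 (x i.1) (y i.1))
    (fun x p => w (x p)) (fun x p => w' (x p)) (fun p x y => hw (x p) (y p))
    ((adv_nonneg g).trans hB.le) (fun x p => hw_le (x p)) fun x p => hw'_le (x p)).comap
      block finProdFinEquiv.symm (fun i x y => ?_) fun x a hxa => hxa).advRel_le
  have hblock : ∀ x : Cube (N * m),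
      block x (finProdFinEquiv.symm i).1 (finProdFinEquiv.symm i).2 = x i := fun x =>
    congrArg x (finProdFinEquiv.apply_symm_apply i)
  simp only [diffMatrix, Matrix.of_apply, hblock]

end UpperBound

end

theorem mainTheorem1 {N m K : ℕ} (f : Set (Cube N × Fin K)) (hf : IsTotalRel f)
    (g : Cube m → Bool) :
    advRel (relComp f g) = advRel f * adv g :=
  le_antisymm (advRel_relComp_le hf g) (advRel_mul_adv_le hf g)
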